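/- Let $\omega_1\supset\omega_2\supset\cdots$ be closed, bounded domains in $\mathbb R^d$ with smooth boundary, and suppose that $G:=\bigcap_{n}\omega_n$ is a closed, bounded domain with Lipschitz boundary (connectedness is not required). Let $f\in L^2(\omega_1)$ be a real- or complex-valued function; for instance, $f\in L^2(G)$ extended by zero. For a closed domain $K$, let $H^1_0(K)$ be the closure in $H^1(\mathbb R^d)$ of the set of test functions $\varphi\in C_c^\infty(\mathbb R^d)$ with support in $K$, and let $H^2(K)$ be the space of functions whose weak derivatives of order at most $2$ in the interior of $K$ are in $L^2$, with the norm $\|v\|_{H^2(K)}=\big(\sum_{k\le 2}\int_K|\nabla^k v|^2\big)^{1/2}$, where $\|v\|_{H^2(K)}=\infty$ if $v\notin H^2(K)$. Let $u_n\in H^1_0(\omega_n)$ and $w\in H^1_0(G)$ satisfy $\Delta u_n=f$ in the interior of $\omega_n$ and $\Delta w=f$ in the interior of $G$, in the sense of distributions. If $w\notin H^2(G)$, then $\|u_n\|_{H^2(\omega_n)}\to\infty$ as $n\to\infty$. -/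

import Mathlib

open MeasureTheory Filter Topology Set
open scoped ENNReal ContDiff

/-- Euclidean `n`-space. -/
abbrev Eucl (n : ℕ) : Type := EuclideanSpace ℝ (Fin n)

/-- Smooth compactly supported functions on `ℝⁿ` whose support lies in the set `A`. -/
def IsTestFunction {n : ℕ} {F : Type*} [NormedAddCommGroup F] [NormedSpace ℝ F]
    (A : Set (Eucl n)) (φ : Eucl n → F) : Prop :=
  ContDiff ℝ ∞ φ ∧ HasCompactSupport φ ∧ tsupport φ ⊆ A

/-- Near `x`, the set `K` is the region on or above the graph of `ψ`, where the vertical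
direction is the unit vector `ν` and `ψ` is defined on the hyperplane orthogonal to `ν`. -/
def IsEpigraphNear {n : ℕ} (K : Set (Eucl n)) (x ν : Eucl n)
    (ψ : (Submodule.span ℝ {ν})ᗮ → ℝ) : Prop :=
  ‖ν‖ = 1 ∧ ∀ᶠ y in 𝓝 x,
    (y ∈ K ↔ ψ ((Submodule.span ℝ {ν})ᗮ.orthogonalProjectionOnto y) ≤ inner ℝ ν y)

/-- Closed, bounded domains in `ℝⁿ` with Lipschitz boundary (not necessarily connected). -/
structure IsClosedLipschitzDomain {n : ℕ} (K : Set (Eucl n)) : Prop where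
  isClosed : IsClosed K
  isBounded : Bornology.IsBounded K
  boundary : ∀ x ∈ frontier K, ∃ (ν : Eucl n) (ψ : (Submodule.span ℝ {ν})ᗮ → ℝ),
    (∃ C, LipschitzWith C ψ) ∧ IsEpigraphNear K x ν ψ

/-- Closed, bounded domains in `ℝⁿ` with smooth boundary (not necessarily connected). -/
structure IsClosedSmoothDomain {n : ℕ} (K : Set (Eucl n)) : Prop where
  isClosed : IsClosed K
  isBounded : Bornology.IsBounded K
  boundary : ∀ x ∈ frontier K, ∃ (ν : Eucl n) (ψ : (Submodule.span ℝ {ν})ᗮ → ℝ),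
    ContDiff ℝ ∞ ψ ∧ IsEpigraphNear K x ν ψ

/-- The partial derivative `∂_{I 0} ⋯ ∂_{I (k-1)} φ`. -/
noncomputable def partialDeriv {n k : ℕ} (I : Fin k → Fin n) (φ : Eucl n → ℝ) (x : Eucl n) : ℝ :=
  iteratedFDeriv ℝ k φ x (fun j => EuclideanSpace.single (I j) (1 : ℝ))

/-- On the open set `U`, the function `g` is the weak partial derivative
`∂_{I 0} ⋯ ∂_{I (k-1)} u`. -/
def IsWeakDeriv {n k : ℕ} {𝕜 : Type*} [RCLike 𝕜] (U : Set (Eucl n)) (I : Fin k → Fin n)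
    (u g : Eucl n → 𝕜) : Prop :=
  LocallyIntegrableOn u U ∧ LocallyIntegrableOn g U ∧
    ∀ φ : Eucl n → ℝ, IsTestFunction U φ →
      ∫ x, partialDeriv I φ x • u x = (-1 : ℝ) ^ k • ∫ x, φ x • g x

/-- The function `u` belongs to `H^m(U)`, for `U` open: its weak derivatives of every order
`k ≤ m` exist and are in `L²(U)`. -/
def MemSobolev {n : ℕ} {𝕜 : Type*} [RCLike 𝕜] (m : ℕ) (U : Set (Eucl n))
    (u : Eucl n → 𝕜) : Prop :=
  ∀ k ≤ m, ∀ I : Fin k → Fin n, ∃ g : Eucl n → 𝕜,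
    IsWeakDeriv U I u g ∧ MemLp g 2 (volume.restrict U)

/-- The `L²(U)`-norm of the weak derivative `∂_{I 0} ⋯ ∂_{I (k-1)} u`; it is `∞` if there is
no such derivative in `L²(U)`. -/
noncomputable def weakDerivNorm {n k : ℕ} {𝕜 : Type*} [RCLike 𝕜] (U : Set (Eucl n))
    (I : Fin k → Fin n) (u : Eucl n → 𝕜) : ℝ≥0∞ :=
  ⨅ (g : Eucl n → 𝕜) (_ : IsWeakDeriv U I u g ∧ MemLp g 2 (volume.restrict U)),
    eLpNorm g 2 (volume.restrict U)

/-- The norm of `H^m(U)`, `(∑_{k ≤ m} ∫_U |∇ᵏ u|²)^{1/2}`; it is `∞` if `u ∉ H^m(U)`. -/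
noncomputable def sobolevNorm {n : ℕ} {𝕜 : Type*} [RCLike 𝕜] (m : ℕ) (U : Set (Eucl n))
    (u : Eucl n → 𝕜) : ℝ≥0∞ :=
  (∑ k ∈ Finset.range (m + 1), ∑ I : Fin k → Fin n, weakDerivNorm U I u ^ 2) ^ (1 / 2 : ℝ)

/-- The space `H^m_0(K)` for a closed set `K`: the closure in `H^m(ℝⁿ)` of the set of test
functions with support in `K`. -/
def MemSobolevZero {n : ℕ} {𝕜 : Type*} [RCLike 𝕜] (m : ℕ) (K : Set (Eucl n))
    (u : Eucl n → 𝕜) : Prop :=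
  MemSobolev m univ u ∧ ∃ φ : ℕ → Eucl n → 𝕜, (∀ k, IsTestFunction K (φ k)) ∧
    Tendsto (fun k => sobolevNorm m univ (φ k - u)) atTop (𝓝 0)

/-- `Δ u = f` in the sense of distributions on the open set `U`. -/
def WeakLaplaceEq {n : ℕ} {𝕜 : Type*} [RCLike 𝕜] (U : Set (Eucl n)) (u f : Eucl n → 𝕜) : Prop :=
  ∀ φ : Eucl n → ℝ, IsTestFunction U φ →
    ∫ x, Laplacian.laplacian φ x • u x = ∫ x, φ x • f x

/-! ### Translations and correlations of square integrable functions -/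

section Translation

variable {n : ℕ}

/-! Argue by contraposition. If the norms do not tend to infinity, they stay bounded along some
ultrafilter finer than `atTop`. By Banach–Alaoglu (`exists_weak_limit`) the zero extensions of `u
k`, of its gradient and of its second derivatives then converge weakly in `L²`. The limit `v` lies
in `H¹(ℝⁿ)`, vanishes off every `Ω m`, hence off `G`, and solves `Δ v = f` inside `G`. If `v` and
`w` have the same gradient, the weak limits of the second derivatives are second derivatives of `w`,
so `w` is in `H²`.

The crux is this uniqueness: `v` is only known to vanish off `G`, not to be a limit of test
functions supported in `G`. Here the Lipschitz boundary enters, through interior cones: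
`HasInteriorCones.sum_integral_mul_eq_zero` says that an `L²` field that is divergence free inside
`K` is orthogonal to the gradient of every `H¹(ℝⁿ)` function vanishing off `K`. Near a boundary
point the field is mollified by a kernel shifted along the cone axis, so that values on `K` only
sample the interior; the mollified field is divergence free there, integration by parts gives zero,
and the kernel then shrinks to a point. Applied to the gradient of `v - w`, this shows that the
gradient vanishes. -/

theorem memLp_comp_sub_const {q : Eucl n → ℝ} (hq : MemLp q 2) (z : Eucl n) :
    MemLp (fun x => q (x - z)) 2 :=
  hq.comp_measurePreserving (measurePreserving_sub_right volume z)

/-- The correlation of two square integrable functions is continuous. -/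
theorem continuous_integral_mul_translate {h q : Eucl n → ℝ} (hh : MemLp h 2) (hq : MemLp q 2) :
    Continuous fun z : Eucl n => ∫ x, h x * q (x - z) := by
  -- Translation acts continuously on `L²`, and the correlation is an inner product with the
  -- translate.
  let T : Eucl n → C(Eucl n, Eucl n) := fun z => ⟨fun x => x - z, by fun_prop⟩
  have hT : Continuous T := ContinuousMap.continuous_of_continuous_uncurry _ (by
    simp only [T, Function.uncurry_def, ContinuousMap.coe_mk]; fun_prop)
  have hm : ∀ z, MeasurePreserving (T z) (volume : Measure (Eucl n)) volume :=
    fun z => measurePreserving_sub_right volume z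
  have h1 : Continuous fun z => Lp.compMeasurePreserving (T z) (hm z) (hq.toLp q) :=
    Continuous.compMeasurePreservingLp continuous_const hT hm (by simp)
  have h2 : Continuous fun z =>
      inner ℝ (hh.toLp h) (Lp.compMeasurePreserving (T z) (hm z) (hq.toLp q)) :=
    continuous_const.inner h1
  convert h2 using 2 with z
  rw [L2.inner_def]
  refine integral_congr_ae ?_
  have e1 := hh.coeFn_toLp
  have e2 := Lp.coeFn_compMeasurePreserving (hq.toLp q) (hm z)
  have e3 := (hm z).quasiMeasurePreserving.ae_eq_comp hq.coeFn_toLp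
  filter_upwards [e1, e2, e3] with x h1 h2 h3
  rw [h1, h2, h3]
  simp [T, mul_comm]

theorem integral_mul_convolution_eq {h q κ : Eucl n → ℝ} (hh : MemLp h 2) (hq : MemLp q 2)
    (hκ : Continuous κ) (hκc : HasCompactSupport κ) :
    ∫ x, h x * ∫ z, κ z * q (x - z) = ∫ z, κ z * ∫ x, h x * q (x - z) := by
  simp_rw [← integral_const_mul]
  rw [integral_integral_swap]
  · refine integral_congr_ae (.of_forall fun z => integral_congr_ae (.of_forall fun x => ?_))
    simp only; ring
  · have hm : AEStronglyMeasurable (Function.uncurry fun x z : Eucl n => h x * (κ z * q (x - z)))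
        (volume.prod volume) := by
      have := hκ.aestronglyMeasurable.convolution_integrand (ContinuousLinearMap.mul ℝ ℝ)
        (ν := volume) (μ := volume) hq.aestronglyMeasurable
      exact (hh.aestronglyMeasurable.comp_fst).mul this
    rw [integrable_prod_iff' hm]
    constructor
    · refine .of_forall fun z => ?_
      have := (hh.integrable_mul (memLp_comp_sub_const hq z)).const_mul (κ z)
      refine this.congr (.of_forall fun x => ?_)
      simp [Function.uncurry]; ring
    -- The inner integral of the norms is a correlation, hence continuous; the factor `‖κ z‖` makes
    -- it compactly supported.
    · have hA := continuous_integral_mul_translate hh.norm hq.norm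
      have : Continuous fun z => ‖κ z‖ * ∫ x, ‖h x‖ * ‖q (x - z)‖ := hκ.norm.mul hA
      refine (this.integrable_of_hasCompactSupport hκc.norm.mul_right).congr
        (.of_forall fun z => ?_)
      simp only [← integral_const_mul]
      refine integral_congr_ae (.of_forall fun x => ?_)
      simp [Function.uncurry]; ring

end Translation

/-! ### Weak compactness in `L²` -/

section WeakLimit

variable {α ι 𝕜 : Type*} [RCLike 𝕜] {m : MeasurableSpace α} {μ : Measure α}

/-- Bounded families in `L²` converge weakly along every ultrafilter. -/
theorem exists_weak_limit (U : Ultrafilter ι) {F : ι → α → 𝕜} {M : ℝ≥0∞} (hM : M ≠ ⊤)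
    (hF : ∀ᶠ k in (U : Filter ι), MemLp (F k) 2 μ ∧ eLpNorm (F k) 2 μ ≤ M) :
    ∃ F₀ : α → 𝕜, MemLp F₀ 2 μ ∧ ∀ ψ : α → 𝕜, MemLp ψ 2 μ →
      Tendsto (fun k => ∫ x, ψ x * F k x ∂μ) U (𝓝 (∫ x, ψ x * F₀ x ∂μ)) := by
  classical
  let X : ι → Lp 𝕜 2 μ := fun k => if h : MemLp (F k) 2 μ then h.toLp (F k) else 0
  let Λ : ι → WeakDual 𝕜 (Lp 𝕜 2 μ) := fun k =>
    StrongDual.toWeakDual (InnerProductSpace.toDual 𝕜 (Lp 𝕜 2 μ) (X k))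
  have hc := WeakDual.isCompact_closedBall (𝕜 := 𝕜) (E := Lp 𝕜 2 μ) 0 M.toReal
  have hΛ : (↑(U.map Λ) : Filter (WeakDual 𝕜 (Lp 𝕜 2 μ))) ≤ 𝓟 (WeakDual.toStrongDual ⁻¹' Metric.closedBall 0 M.toReal) := by
    rw [le_principal_iff]
    change ∀ᶠ k in (U : Filter ι), _ ∈ _
    filter_upwards [hF] with k hk
    simp only [mem_preimage, Metric.mem_closedBall, dist_zero_right, Λ]
    change ‖InnerProductSpace.toDual 𝕜 (Lp 𝕜 2 μ) (X k)‖ ≤ _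
    rw [LinearIsometryEquiv.norm_map]
    simp only [X, dif_pos hk.1, Lp.norm_toLp]
    exact ENNReal.toReal_mono hM hk.2
  obtain ⟨Λ₀, -, h0⟩ := hc.ultrafilter_le_nhds (U.map Λ) hΛ
  let Y : Lp 𝕜 2 μ := (InnerProductSpace.toDual 𝕜 (Lp 𝕜 2 μ)).symm (WeakDual.toStrongDual Λ₀)
  refine ⟨Y, Lp.memLp Y, fun ψ hψ => ?_⟩
  -- The inner product is conjugate linear in its first slot; conjugating both `ψ` and the result
  -- yields the bilinear pairing.
  have hψ' : MemLp (fun x => star (ψ x)) 2 μ := hψ.star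
  have h1 : Tendsto (fun k => inner 𝕜 (X k) (hψ'.toLp _)) U (𝓝 (inner 𝕜 Y (hψ'.toLp _))) := by
    have := ((WeakDual.eval_continuous (hψ'.toLp _)).tendsto Λ₀).comp (show Tendsto Λ U (𝓝 Λ₀) from h0)
    have e : inner 𝕜 Y (hψ'.toLp _) = Λ₀ (hψ'.toLp _) := by
      simp only [Y, InnerProductSpace.toDual_symm_apply]; rfl
    rw [e]; exact this
  have h2 := (RCLike.continuous_conj (K := 𝕜)).continuousAt.tendsto.comp h1
  have key : ∀ Z : Lp 𝕜 2 μ, (starRingEnd 𝕜) (inner 𝕜 Z (hψ'.toLp _)) = ∫ x, ψ x * Z x ∂μ := by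
    intro Z
    rw [inner_conj_symm, L2.inner_def]
    refine integral_congr_ae ?_
    filter_upwards [hψ'.coeFn_toLp] with x hx
    rw [hx]; simp [mul_comm]
  rw [key] at h2
  refine h2.congr' ?_
  filter_upwards [hF] with k hk
  simp only [Function.comp, key]
  refine integral_congr_ae ?_
  have := hk.1.coeFn_toLp
  filter_upwards [this] with x hx
  simp only [X, dif_pos hk.1, hx]

end WeakLimit

/-! ### Interior cones of Lipschitz and smooth domains -/

section Cone

variable {n : ℕ}

/-- `K` satisfies a uniform interior cone condition near each of its points. -/
def HasInteriorCones {n : ℕ} (K : Set (Eucl n)) : Prop :=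
  ∀ x ∈ K, ∃ (ν : Eucl n) (r c : ℝ), 0 < r ∧ 0 < c ∧ ∀ y ∈ K ∩ Metric.ball x r, ∀ t ∈ Ioo 0 r,
    Metric.closedBall (y + t • ν) (c * t) ⊆ interior K

/-- Moving up by `t` and then by `e` gains at least `t - ‖e‖` in height, while the graph rises by at
most `C * ‖e‖`. A local Lipschitz bound suffices, which covers smooth graphs too. -/
theorem IsEpigraphNear.exists_interior_cones {K : Set (Eucl n)} {x ν : Eucl n}
    {ψ : (Submodule.span ℝ {ν})ᗮ → ℝ} (h : IsEpigraphNear K x ν ψ)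
    (hψ : ∃ C, ∃ s ∈ 𝓝 ((Submodule.span ℝ {ν})ᗮ.orthogonalProjectionOnto x), LipschitzOnWith C ψ s) :
    ∃ (r c : ℝ), 0 < r ∧ 0 < c ∧ ∀ y ∈ K ∩ Metric.ball x r, ∀ t ∈ Ioo 0 r,
      Metric.closedBall (y + t • ν) (c * t) ⊆ interior K := by
  obtain ⟨hν, hK⟩ := h
  obtain ⟨C, s, hs, hC⟩ := hψ
  set P := (Submodule.span ℝ {ν})ᗮ.orthogonalProjectionOnto with hP
  have hPs : ∀ᶠ y in 𝓝 x, P y ∈ s := P.continuous.continuousAt.eventually_mem hs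
  obtain ⟨R, hR, hb⟩ := Metric.eventually_nhds_iff_ball.1 (hK.and hPs)
  have hPν : P ν = 0 :=
    Submodule.orthogonalProjectionOnto_orthogonal_apply_eq_zero (Submodule.mem_span_singleton_self ν)
  have hC0 : (0 : ℝ) ≤ C := C.2
  -- This aperture puts the closed ball inside an open ball where `‖e‖ * (C + 1) ≤ t / 2`; the
  -- radius `R / 4` keeps all points in the chart.
  refine ⟨R / 4, 1 / (4 * (C + 1)), by positivity, by positivity, ?_⟩
  rintro y ⟨hyK, hy⟩ t ⟨ht0, htR⟩
  have hct : 2 * (1 / (4 * ((C : ℝ) + 1)) * t) = t / (2 * (C + 1)) := by field_simp; norm_num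
  have hct2 : t / (2 * ((C : ℝ) + 1)) * (C + 1) = t / 2 := by field_simp
  have hcp : 0 < 1 / (4 * ((C : ℝ) + 1)) * t := by positivity
  refine (Metric.closedBall_subset_ball (ε₂ := t / (2 * (C + 1))) (by linarith)).trans
    (interior_maximal ?_ Metric.isOpen_ball)
  intro z hz
  obtain ⟨e, rfl⟩ : ∃ e, z = y + t • ν + e := ⟨z - (y + t • ν), by abel⟩
  have he : ‖e‖ < t / (2 * (C + 1)) := by simpa [dist_eq_norm] using hz
  have he2 : ‖e‖ * (C + 1) ≤ t / 2 := by
    rw [← hct2]; gcongr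
  have he3 : 0 ≤ ‖e‖ * C := by positivity
  have hyx : ‖y - x‖ < R / 4 := by simpa [dist_eq_norm] using hy
  have hyR : y ∈ Metric.ball x R := Metric.ball_subset_ball (by linarith) hy
  have hzR : y + t • ν + e ∈ Metric.ball x R := by
    rw [Metric.mem_ball, dist_eq_norm, show y + t • ν + e - x = (y - x) + t • ν + e by abel]
    have h1 := norm_add₃_le (a := y - x) (b := t • ν) (c := e)
    have h2 : ‖t • ν‖ = t := by rw [norm_smul, hν, Real.norm_of_nonneg ht0.le, mul_one]
    linarith
  rw [(hb _ hzR).1]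
  have hy1 := (hb _ hyR).1.1 hyK
  have hL := hC.dist_le_mul _ (hb _ hzR).2 _ (hb _ hyR).2
  have hPe : ‖P e‖ ≤ ‖e‖ := Submodule.norm_orthogonalProjectionOnto_apply_le _ e
  have hPt : P (t • ν + e) = P e := by rw [map_add, map_smul, hPν, smul_zero, zero_add]
  rw [Real.dist_eq, dist_eq_norm, ← map_sub,
    show y + t • ν + e - y = t • ν + e by abel, hPt] at hL
  have h3 := (abs_le.1 hL).2
  have h4 : (C : ℝ) * ‖P e‖ ≤ C * ‖e‖ := by gcongr
  have h5 : |inner ℝ ν e| ≤ ‖e‖ := by simpa [hν] using abs_real_inner_le_norm ν e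
  have h6 := (abs_le.1 h5).1
  rw [inner_add_right, inner_add_right, inner_smul_right, real_inner_self_eq_norm_sq, hν]
  linarith

theorem hasInteriorCones_of_frontier {K : Set (Eucl n)}
    (h : ∀ x ∈ frontier K, ∃ (ν : Eucl n) (r c : ℝ), 0 < r ∧ 0 < c ∧
      ∀ y ∈ K ∩ Metric.ball x r, ∀ t ∈ Ioo 0 r,
        Metric.closedBall (y + t • ν) (c * t) ⊆ interior K) :
    HasInteriorCones K := by
  intro x hx
  by_cases hxi : x ∈ interior K
  · obtain ⟨R, hR, hb⟩ := Metric.isOpen_iff.1 isOpen_interior x hxi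
    refine ⟨0, R / 2, 1, by positivity, one_pos, ?_⟩
    rintro y ⟨-, hy⟩ t ⟨ht0, htR⟩
    refine subset_trans (fun z hz => ?_) hb
    simp only [smul_zero, add_zero, one_mul, Metric.mem_closedBall, Metric.mem_ball] at *
    linarith [dist_triangle z y x]
  · exact h x ⟨subset_closure hx, hxi⟩

theorem IsClosedLipschitzDomain.hasInteriorCones {K : Set (Eucl n)}
    (hK : IsClosedLipschitzDomain K) : HasInteriorCones K := by
  refine hasInteriorCones_of_frontier fun x hx => ?_
  obtain ⟨ν, ψ, ⟨C, hC⟩, hψ⟩ := hK.boundary x hx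
  exact ⟨ν, hψ.exists_interior_cones ⟨C, univ, univ_mem, hC.lipschitzOnWith⟩⟩

theorem IsClosedSmoothDomain.hasInteriorCones {K : Set (Eucl n)}
    (hK : IsClosedSmoothDomain K) : HasInteriorCones K := by
  refine hasInteriorCones_of_frontier fun x hx => ?_
  obtain ⟨ν, ψ, hC, hψ⟩ := hK.boundary x hx
  exact ⟨ν, hψ.exists_interior_cones
    (hC.contDiffAt.of_le (by exact_mod_cast le_top)).exists_lipschitzOnWith⟩

end Cone

/-! ### Calculus of weak gradients in `H¹(ℝⁿ)` -/

section WeakGradient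

variable {n : ℕ} {𝕜 : Type*} [RCLike 𝕜]

/-- The classical partial derivative in the `i`-th coordinate direction. -/
noncomputable def coordDeriv (i : Fin n) (φ : Eucl n → ℝ) (x : Eucl n) : ℝ :=
  fderiv ℝ φ x (EuclideanSpace.single i (1 : ℝ))

theorem contDiff_coordDeriv {φ : Eucl n → ℝ} (hφ : ContDiff ℝ ∞ φ) (i : Fin n) :
    ContDiff ℝ ∞ (coordDeriv i φ) :=
  (hφ.fderiv_right (m := ∞) (by simp)).clm_apply contDiff_const

theorem tsupport_coordDeriv_subset (φ : Eucl n → ℝ) (i : Fin n) :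
    tsupport (coordDeriv i φ) ⊆ tsupport φ :=
  tsupport_fderiv_apply_subset ℝ _

theorem hasCompactSupport_coordDeriv {φ : Eucl n → ℝ} (hφ : HasCompactSupport φ) (i : Fin n) :
    HasCompactSupport (coordDeriv i φ) :=
  hφ.fderiv_apply (𝕜 := ℝ) _

theorem coordDeriv_mul {φ ψ : Eucl n → ℝ} (hφ : ContDiff ℝ ∞ φ) (hψ : ContDiff ℝ ∞ ψ)
    (i : Fin n) (x : Eucl n) :
    coordDeriv i (fun y => φ y * ψ y) x = coordDeriv i φ x * ψ x + φ x * coordDeriv i ψ x := by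
  have h1 := (hφ.differentiable (by simp)) x
  have h2 := (hψ.differentiable (by simp)) x
  simp only [coordDeriv]
  rw [fderiv_fun_mul h1 h2]
  simp; ring

theorem IsTestFunction.coordDeriv {U : Set (Eucl n)} {φ : Eucl n → ℝ} (hφ : IsTestFunction U φ)
    (i : Fin n) : IsTestFunction U (coordDeriv i φ) :=
  ⟨contDiff_coordDeriv hφ.1 i, hasCompactSupport_coordDeriv hφ.2.1 i,
    (tsupport_coordDeriv_subset φ i).trans hφ.2.2⟩

theorem IsTestFunction.memLp {F : Type*} [NormedAddCommGroup F] [NormedSpace ℝ F]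
    {U : Set (Eucl n)} {φ : Eucl n → F} (hφ : IsTestFunction U φ) (p : ℝ≥0∞) :
    MemLp φ p :=
  hφ.1.continuous.memLp_of_hasCompactSupport hφ.2.1

/-- `v` belongs to `H¹(ℝⁿ)`, with weak gradient `g`. -/
structure HasWeakGrad (v : Eucl n → 𝕜) (g : Fin n → Eucl n → 𝕜) : Prop where
  memLp : MemLp v 2
  memLp_grad : ∀ i, MemLp (g i) 2
  integral_eq : ∀ i (φ : Eucl n → ℝ), IsTestFunction univ φ →
    ∫ x, coordDeriv i φ x • v x = -∫ x, φ x • g i x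

theorem IsTestFunction.memLp_mul {φ v : Eucl n → ℝ} {U : Set (Eucl n)} (hφ : IsTestFunction U φ)
    (hv : MemLp v 2) : MemLp (fun x => φ x * v x) 2 :=
  hv.mul (hφ.memLp ∞)

theorem IsTestFunction.integrable_smul {φ : Eucl n → ℝ} {v : Eucl n → 𝕜} {U : Set (Eucl n)}
    (hφ : IsTestFunction U φ) (hv : MemLp v 2) : Integrable (fun x => φ x • v x) :=
  memLp_one_iff_integrable.1 (hv.smul (hφ.memLp 2))

theorem IsTestFunction.mul_left {φ ψ : Eucl n → ℝ} {U : Set (Eucl n)} (hφ : IsTestFunction U φ)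
    (hψ : ContDiff ℝ ∞ ψ) : IsTestFunction U (fun x => φ x * ψ x) :=
  ⟨hφ.1.mul hψ, hφ.2.1.mul_right, (tsupport_mul_subset_left).trans hφ.2.2⟩

theorem HasWeakGrad.mul {v : Eucl n → ℝ} {g : Fin n → Eucl n → ℝ} (h : HasWeakGrad v g)
    {b : Eucl n → ℝ} (hb : IsTestFunction univ b) :
    HasWeakGrad (fun x => b x * v x) (fun i x => coordDeriv i b x * v x + b x * g i x) where
  memLp := hb.memLp_mul h.memLp
  memLp_grad i := ((hb.coordDeriv i).memLp_mul h.memLp).add (hb.memLp_mul (h.memLp_grad i))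
  integral_eq i φ hφ := by
    have h1 := h.integral_eq i _ (hφ.mul_left hb.1)
    have i1 := ((hφ.coordDeriv i).mul_left hb.1).integrable_smul h.memLp
    have i2 := (hφ.mul_left (hb.coordDeriv i).1).integrable_smul h.memLp
    have i3 := (hφ.mul_left hb.1).integrable_smul (h.memLp_grad i)
    simp_rw [coordDeriv_mul hφ.1 hb.1, add_smul] at h1
    rw [integral_add i1 i2] at h1
    have e1 : ∫ x, coordDeriv i φ x • (b x * v x) = ∫ x, (coordDeriv i φ x * b x) • v x := by
      simp only [smul_eq_mul, mul_assoc]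
    have e2 : ∫ x, φ x • (coordDeriv i b x * v x + b x * g i x) =
        (∫ x, (φ x * coordDeriv i b x) • v x) + ∫ x, (φ x * b x) • g i x := by
      rw [← integral_add i2 i3]
      simp only [smul_eq_mul, mul_assoc, mul_add]
    rw [e1, e2]; linarith

theorem HasWeakGrad.sub {v v' : Eucl n → 𝕜} {g g' : Fin n → Eucl n → 𝕜} (h : HasWeakGrad v g)
    (h' : HasWeakGrad v' g') :
    HasWeakGrad (fun x => v x - v' x) (fun i x => g i x - g' i x) where
  memLp := h.memLp.sub h'.memLp
  memLp_grad i := (h.memLp_grad i).sub (h'.memLp_grad i)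
  integral_eq i φ hφ := by
    simp_rw [smul_sub]
    rw [integral_sub ((hφ.coordDeriv i).integrable_smul h.memLp)
      ((hφ.coordDeriv i).integrable_smul h'.memLp), integral_sub (hφ.integrable_smul
      (h.memLp_grad i)) (hφ.integrable_smul (h'.memLp_grad i)), h.integral_eq i φ hφ,
      h'.integral_eq i φ hφ]
    ring

theorem HasWeakGrad.grad_eq_zero {v : Eucl n → 𝕜} {g : Fin n → Eucl n → 𝕜} (h : HasWeakGrad v g)
    (hv : v =ᵐ[volume] 0) (i : Fin n) : g i =ᵐ[volume] 0 := by
  refine ae_eq_zero_of_integral_contDiff_smul_eq_zero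
    ((h.memLp_grad i).locallyIntegrable (by norm_num)) fun φ h1 h2 => ?_
  have := h.integral_eq i φ ⟨h1, h2, subset_univ _⟩
  rw [← neg_eq_iff_eq_neg.2 this, integral_eq_zero_of_ae, neg_zero]
  filter_upwards [hv] with x hx
  simp [hx]

theorem HasWeakGrad.comp_clm {v : Eucl n → 𝕜} {g : Fin n → Eucl n → 𝕜} (h : HasWeakGrad v g)
    (L : 𝕜 →L[ℝ] ℝ) : HasWeakGrad (fun x => L (v x)) (fun i x => L (g i x)) where
  memLp := L.comp_memLp' h.memLp
  memLp_grad i := L.comp_memLp' (h.memLp_grad i)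
  integral_eq i φ hφ := by
    simp_rw [← map_smul]
    rw [L.integral_comp_comm ((hφ.coordDeriv i).integrable_smul h.memLp),
      L.integral_comp_comm (hφ.integrable_smul (h.memLp_grad i)), h.integral_eq i φ hφ, map_neg]

end WeakGradient

/-! ### Divergence-free fields are orthogonal to gradients -/

section Orthogonality

variable {n : ℕ}

open scoped Convolution in
theorem contDiff_convolution_mul {q κ : Eucl n → ℝ} (hq : MemLp q 2) (hκ : IsTestFunction univ κ) :
    ContDiff ℝ ∞ (q ⋆[ContinuousLinearMap.mul ℝ ℝ] κ) := by
  exact hκ.2.1.contDiff_convolution_right _ (hq.locallyIntegrable (by norm_num)) hκ.1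

open scoped Convolution in
theorem coordDeriv_convolution_mul {q κ : Eucl n → ℝ} (hq : MemLp q 2)
    (hκ : IsTestFunction univ κ) (i : Fin n) (x : Eucl n) :
    coordDeriv i (q ⋆[ContinuousLinearMap.mul ℝ ℝ] κ) x =
      ∫ z, coordDeriv i κ (x - z) * q z := by
  have hql := hq.locallyIntegrable (by norm_num)
  have h := hκ.2.1.hasFDerivAt_convolution_right (ContinuousLinearMap.mul ℝ ℝ) hql
    (hκ.1.of_le (by simp)) x
  rw [coordDeriv, h.fderiv, convolution_precompR_apply _ hql (hκ.2.1.fderiv (𝕜 := ℝ))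
    (hκ.1.continuous_fderiv (by simp))]
  simp only [convolution_def, ContinuousLinearMap.mul_apply', coordDeriv, mul_comm]

theorem coordDeriv_const_sub {κ : Eucl n → ℝ} (hκ : ContDiff ℝ ∞ κ) (i : Fin n) (x z : Eucl n) :
    coordDeriv i (fun y => κ (x - y)) z = -coordDeriv i κ (x - z) := by
  have h1 := (hκ.differentiable (by simp) (x - z)).hasFDerivAt
  have h2 := h1.comp z ((hasFDerivAt_id z).const_sub x)
  simp only [coordDeriv]
  rw [show (fun y => κ (x - y)) = κ ∘ HSub.hSub x from rfl, h2.fderiv]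
  simp

open scoped Convolution in
/-- A mollification of a field that is weakly divergence free in the interior of `K` is orthogonal
to localized gradients of functions vanishing off `K`, if the mollifier looks into `K`. -/
theorem sum_integral_mul_convolution_eq_zero {K B : Set (Eucl n)} {q : Fin n → Eucl n → ℝ}
    (hq : ∀ i, MemLp (q i) 2)
    (hdiv : ∀ φ, IsTestFunction (interior K) φ → ∑ i, ∫ x, coordDeriv i φ x * q i x = 0)
    {v : Eucl n → ℝ} {g : Fin n → Eucl n → ℝ} (hv : HasWeakGrad v g)
    (hvK : ∀ᵐ x, x ∉ K → v x = 0) {χ : Eucl n → ℝ} (hχ : IsTestFunction B χ)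
    {κ : Eucl n → ℝ} (hκ : IsTestFunction univ κ)
    (hκK : ∀ y ∈ K ∩ B, IsTestFunction (interior K) fun z => κ (y - z)) :
    ∑ i, ∫ x, (coordDeriv i χ x * v x + χ x * g i x) *
      (q i ⋆[ContinuousLinearMap.mul ℝ ℝ] κ) x = 0 := by
  let Q : Fin n → Eucl n → ℝ := fun i => q i ⋆[ContinuousLinearMap.mul ℝ ℝ] κ
  have hQs : ∀ i, ContDiff ℝ ∞ (Q i) := fun i => contDiff_convolution_mul (hq i) hκ
  have hχu : IsTestFunction univ χ := ⟨hχ.1, hχ.2.1, subset_univ _⟩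
  have int : ∀ i, Integrable fun x => (χ x * coordDeriv i (Q i) x) • v x := fun i =>
    (hχ.mul_left (contDiff_coordDeriv (hQs i) i)).integrable_smul hv.memLp
  have key : ∀ i, ∫ x, (coordDeriv i χ x * v x + χ x * g i x) * Q i x =
      -∫ x, (χ x * coordDeriv i (Q i) x) • v x := by
    intro i
    have h1 := hv.integral_eq i _ (hχu.mul_left (hQs i))
    have i1 := ((hχ.coordDeriv i).mul_left (hQs i)).integrable_smul hv.memLp
    have i3 := (hχ.mul_left (hQs i)).integrable_smul (hv.memLp_grad i)
    simp_rw [coordDeriv_mul hχ.1 (hQs i), add_smul] at h1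
    rw [integral_add i1 (int i)] at h1
    have e : ∫ x, (coordDeriv i χ x * v x + χ x * g i x) * Q i x =
        (∫ x, (coordDeriv i χ x * Q i x) • v x) + ∫ x, (χ x * Q i x) • g i x := by
      rw [← integral_add i1 i3]
      refine integral_congr_ae (.of_forall fun x => ?_)
      simp only [smul_eq_mul]; ring
    rw [e]; linarith
  -- The integrand is now `-χ v div Q`: `v` vanishes off `K`, `χ` off `B`, and `div Q` on `K ∩ B`,
  -- where the reflected kernel is an admissible test function.
  rw [Finset.sum_congr rfl fun i _ => key i]
  rw [Finset.sum_neg_distrib, ← integral_finsetSum _ fun i _ => int i, neg_eq_zero]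
  refine integral_eq_zero_of_ae ?_
  filter_upwards [hvK] with x hx
  by_cases hxK : x ∈ K
  · by_cases hxB : x ∈ B
    · have h2 : ∑ i, coordDeriv i (Q i) x = 0 := by
        have h3 := hdiv _ (hκK x ⟨hxK, hxB⟩)
        simp_rw [coordDeriv_const_sub hκ.1, neg_mul, integral_neg] at h3
        rw [Finset.sum_neg_distrib, neg_eq_zero] at h3
        rw [← h3]
        exact Finset.sum_congr rfl fun i _ => coordDeriv_convolution_mul (hq i) hκ i x
      simp only [smul_eq_mul, Pi.zero_apply]
      rw [← Finset.sum_mul, ← Finset.mul_sum, h2]; simp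
    · have : χ x = 0 := image_eq_zero_of_notMem_tsupport fun h => hxB (hχ.2.2 h)
      simp [this]
  · simp [hx hxK]

/-- The local case. By Fubini the pairing with the mollified field is the average of the continuous
correlation `A` against the kernel; it is zero for small `t > 0` and tends to `A 0`, the pairing
with `q` itself. -/
theorem sum_integral_mul_eq_zero_of_tsupport_subset {K : Set (Eucl n)} {x₀ ν : Eucl n} {r c : ℝ}
    (hr : 0 < r) (hc : 0 < c)
    (hcone : ∀ y ∈ K ∩ Metric.ball x₀ r, ∀ t ∈ Ioo 0 r,
      Metric.closedBall (y + t • ν) (c * t) ⊆ interior K)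
    {q : Fin n → Eucl n → ℝ} (hq : ∀ i, MemLp (q i) 2)
    (hdiv : ∀ φ, IsTestFunction (interior K) φ → ∑ i, ∫ x, coordDeriv i φ x * q i x = 0)
    {v : Eucl n → ℝ} {g : Fin n → Eucl n → ℝ} (hv : HasWeakGrad v g)
    (hvK : ∀ᵐ x, x ∉ K → v x = 0) {χ : Eucl n → ℝ} (hχ : IsTestFunction (Metric.ball x₀ r) χ) :
    ∑ i, ∫ x, (coordDeriv i χ x * v x + χ x * g i x) * q i x = 0 := by
  have hχu : IsTestFunction univ χ := ⟨hχ.1, hχ.2.1, subset_univ _⟩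
  set h : Fin n → Eucl n → ℝ := fun i x => coordDeriv i χ x * v x + χ x * g i x with hh
  have hhm : ∀ i, MemLp (h i) 2 := fun i => (hv.mul hχu).memLp_grad i
  let A : Eucl n → ℝ := fun z => ∑ i, ∫ x, h i x * q i (x - z)
  have hA : Continuous A :=
    continuous_finsetSum _ fun i _ => continuous_integral_mul_translate (hhm i) (hq i)
  -- The value `1` for `t ≤ 0` only keeps the bump radii positive.
  let ρ : ℝ → ℝ := fun t => if 0 < t then c * t else 1
  have hρ : ∀ t, 0 < ρ t := fun t => by simp only [ρ]; split_ifs <;> positivity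
  -- With this centre, `z ↦ κ t (y - z)` is supported in the cone ball about `y + t • ν`.
  let b : (t : ℝ) → ContDiffBump (-(t • ν)) := fun t => ⟨ρ t / 2, ρ t, half_pos (hρ t),
    half_lt_self (hρ t)⟩
  let κ : ℝ → Eucl n → ℝ := fun t => (b t).normed volume
  have hκ : ∀ t, IsTestFunction univ (κ t) := fun t =>
    ⟨(b t).contDiff_normed, (b t).hasCompactSupport_normed, subset_univ _⟩
  -- Reflecting `A` makes the convolution at `0` equal to `∫ κ t z * A z`.
  have hlim : Tendsto (fun t => convolution (κ t) (fun z => A (-z))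
      (ContinuousLinearMap.lsmul ℝ ℝ) volume 0) (𝓝[>] 0) (𝓝 (A (-0))) := by
    refine convolution_tendsto_right (k := fun _ => 0) (x₀ := 0)
      (.of_forall fun t => (b t).nonneg_normed)
      (.of_forall fun t => (b t).integral_normed) ?_
      (.of_forall fun _ => (hA.comp continuous_neg).aestronglyMeasurable)
      (((hA.comp continuous_neg).tendsto 0).comp tendsto_snd) tendsto_const_nhds
    rw [tendsto_smallSets_iff]
    intro s hs
    obtain ⟨ε, hε, hb⟩ := Metric.mem_nhds_iff.1 hs
    have : Tendsto (fun t : ℝ => t * (‖ν‖ + c)) (𝓝[>] 0) (𝓝 0) := by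
      refine ((Continuous.tendsto' (by fun_prop) 0 0 (by simp))).mono_left nhdsWithin_le_nhds
    filter_upwards [this.eventually_lt_const hε, self_mem_nhdsWithin] with t ht ht0
    rw [(b t).support_normed_eq]
    refine subset_trans (fun z hz => ?_) hb
    have ht0 : 0 < t := ht0
    simp only [b, ρ, if_pos ht0, Metric.mem_ball, dist_eq_norm, sub_neg_eq_add, sub_zero] at hz ⊢
    have h1 : ‖z‖ ≤ ‖z + t • ν‖ + ‖t • ν‖ := by simpa using norm_sub_le (z + t • ν) (t • ν)
    rw [norm_smul, Real.norm_of_nonneg ht0.le] at h1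
    linarith
  have hev : ∀ᶠ t in 𝓝[>] (0 : ℝ), convolution (κ t) (fun z => A (-z))
      (ContinuousLinearMap.lsmul ℝ ℝ) volume 0 = 0 := by
    filter_upwards [Ioo_mem_nhdsGT hr] with t ht
    have hz := sum_integral_mul_convolution_eq_zero (B := Metric.ball x₀ r) hq hdiv hv hvK hχ (hκ t)
      (fun y hy => by
        refine ⟨(hκ t).1.comp (contDiff_const.sub contDiff_id),
          (hκ t).2.1.comp_homeomorph (Homeomorph.subLeft y), ?_⟩
        refine subset_trans (closure_minimal (t := Metric.closedBall (y + t • ν) (c * t)) ?_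
          Metric.isClosed_closedBall) (hcone y hy t ht)
        intro z hz
        have : y - z ∈ Function.support (κ t) := hz
        rw [(b t).support_normed_eq] at this
        simp only [b, ρ, if_pos ht.1, Metric.mem_ball, dist_eq_norm] at this
        rw [Metric.mem_closedBall, dist_comm, dist_eq_norm]
        rw [show y + t • ν - z = y - z - -(t • ν) by abel]
        exact this.le)
    simp only [convolution_def, ContinuousLinearMap.lsmul_apply, smul_eq_mul, zero_sub, neg_neg, A,
      Finset.mul_sum]
    rw [integral_finsetSum]
    · rw [← hz]
      refine Finset.sum_congr rfl fun i _ => ?_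
      rw [← integral_mul_convolution_eq (hhm i) (hq i) (hκ t).1.continuous (hκ t).2.1]
      refine integral_congr_ae (.of_forall fun x => ?_)
      simp only [hh, convolution_def, ContinuousLinearMap.mul_apply']
      congr 1
      rw [← integral_sub_left_eq_self _ _ x]
      simp [mul_comm]
    · intro i _
      exact ((hκ t).1.continuous.mul (continuous_integral_mul_translate (hhm i)
        (hq i))).integrable_of_hasCompactSupport (hκ t).2.1.mul_right
  have := tendsto_nhds_unique (hlim.congr' hev) tendsto_const_nhds
  simpa [A] using this

/-- A field that is weakly divergence free in the interior of `K` is orthogonal to the gradients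
of all `H¹(ℝⁿ)` functions that vanish off `K`. -/
theorem HasInteriorCones.sum_integral_mul_eq_zero {K : Set (Eucl n)} (hK : HasInteriorCones K)
    (hKc : IsCompact K) {q : Fin n → Eucl n → ℝ} (hq : ∀ i, MemLp (q i) 2)
    (hdiv : ∀ φ, IsTestFunction (interior K) φ → ∑ i, ∫ x, coordDeriv i φ x * q i x = 0)
    {v : Eucl n → ℝ} {g : Fin n → Eucl n → ℝ} (hv : HasWeakGrad v g)
    (hvK : ∀ᵐ x, x ∉ K → v x = 0) :
    ∑ i, ∫ x, g i x * q i x = 0 := by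
  choose! ν r c hr hc hcone using hK
  obtain ⟨s, hsK, hs⟩ := hKc.elim_nhds_subcover (fun x => Metric.ball x (r x / 2))
    fun x hx => Metric.ball_mem_nhds x (half_pos (hr x hx))
  -- Instead of a partition of unity, balls are removed one at a time: `v = b v + (v - b v)`, where
  -- the local case handles `b v` and the remainder vanishes on the ball about `a`.
  have main : ∀ s : Finset (Eucl n), (∀ x ∈ s, x ∈ K) → ∀ (v : Eucl n → ℝ)
      (g : Fin n → Eucl n → ℝ), HasWeakGrad v g → (∀ᵐ x, x ∉ K → v x = 0) →
      (∀ᵐ x, x ∉ ⋃ y ∈ s, Metric.ball y (r y / 2) → v x = 0) →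
      ∑ i, ∫ x, g i x * q i x = 0 := by
    classical
    intro s
    induction s using Finset.induction_on with
    | empty =>
      intro _ v g hv _ h0
      have : v =ᵐ[volume] 0 := by
        filter_upwards [h0] with x hx
        exact hx (by simp)
      refine Finset.sum_eq_zero fun i _ => integral_eq_zero_of_ae ?_
      filter_upwards [hv.grad_eq_zero this i] with x hx
      simp [hx]
    | insert a s has ih =>
      intro hs v g hv hvK h0
      have haK := hs a (Finset.mem_insert_self _ _)
      have hra := hr a haK
      -- Equal to `1` on the covering ball, yet supported strictly inside the ball where cones
      -- exist.
      let b : ContDiffBump a := ⟨r a / 2, 3 * r a / 4, by linarith, by linarith⟩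
      have hb : IsTestFunction (Metric.ball a (r a)) b := by
        refine ⟨b.contDiff, b.hasCompactSupport, ?_⟩
        rw [b.tsupport_eq]
        exact Metric.closedBall_subset_ball (by simp only [b]; linarith)
      have hbu : IsTestFunction univ b := ⟨hb.1, hb.2.1, subset_univ _⟩
      have h1 := sum_integral_mul_eq_zero_of_tsupport_subset hra (hc a haK) (hcone a haK) hq hdiv
        hv hvK hb
      have h2 := ih (fun x hx => hs x (Finset.mem_insert_of_mem hx)) _ _ (hv.sub (hv.mul hbu))
        (by filter_upwards [hvK] with x hx hxK; simp [hx hxK])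
        (by
          filter_upwards [h0] with x hx hxs
          by_cases hxa : x ∈ Metric.ball a (r a / 2)
          · have : b x = 1 := b.one_of_mem_closedBall (Metric.ball_subset_closedBall hxa)
            simp [this]
          · rw [hx]
            · simp
            · simpa [hxa] using hxs)
      rw [← h1, ← sub_eq_zero, ← Finset.sum_sub_distrib, ← h2]
      refine Finset.sum_congr rfl fun i _ => ?_
      simp_rw [sub_mul]
      exact (integral_sub ((hv.memLp_grad i).integrable_mul (hq i))
        (((hv.mul hbu).memLp_grad i).integrable_mul (hq i))).symm
  refine main s hsK v g hv hvK ?_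
  filter_upwards [hvK] with x hx hxs
  exact hx fun hxK => hxs (hs hxK)

end Orthogonality

/-! ### Vanishing of gradients -/

section VanishingGradient

variable {n : ℕ} {𝕜 : Type*} [RCLike 𝕜]

/-- The field with single component `g i` cut off to the complement of the interior is zero inside,
hence divergence free there. Orthogonality gives `∫ (g i)² = 0` over that complement. -/
theorem HasInteriorCones.grad_eq_zero_off_interior_real {K : Set (Eucl n)}
    (hK : HasInteriorCones K) (hKc : IsCompact K) {v : Eucl n → ℝ} {g : Fin n → Eucl n → ℝ}
    (hv : HasWeakGrad v g) (hvK : ∀ᵐ x, x ∉ K → v x = 0) (i : Fin n) :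
    ∀ᵐ x, x ∉ interior K → g i x = 0 := by
  classical
  have hm : MeasurableSet (interior K)ᶜ := isOpen_interior.measurableSet.compl
  have hgi : MemLp ((interior K)ᶜ.indicator (g i)) 2 := (hv.memLp_grad i).indicator hm
  have h := hK.sum_integral_mul_eq_zero hKc
    (q := fun j => if j = i then (interior K)ᶜ.indicator (g i) else 0)
    (fun j => by split_ifs; exacts [hgi, MemLp.zero])
    (fun φ hφ => Finset.sum_eq_zero fun j _ => integral_eq_zero_of_ae (.of_forall fun x => by
      by_cases hx : x ∈ interior K
      · simp only; split_ifs <;> simp [hx]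
      · have : coordDeriv j φ x = 0 :=
          image_eq_zero_of_notMem_tsupport fun h => hx ((hφ.coordDeriv j).2.2 h)
        simp [this])) hv hvK
  rw [Finset.sum_eq_single i (fun j _ hj => by simp [hj]) (by simp)] at h
  simp only [if_true] at h
  have h2 := (integral_eq_zero_iff_of_nonneg (fun x => ?_)
    ((hv.memLp_grad i).integrable_mul hgi)).1 h
  · filter_upwards [h2] with x hx hxK
    simpa [hxK] using hx
  · by_cases hx : x ∈ interior K
    · simp [hx]
    · simp [hx, mul_self_nonneg]

/-- The gradient is orthogonal to itself. -/
theorem HasInteriorCones.grad_eq_zero_of_divergence_real {K : Set (Eucl n)}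
    (hK : HasInteriorCones K) (hKc : IsCompact K) {v : Eucl n → ℝ} {g : Fin n → Eucl n → ℝ}
    (hv : HasWeakGrad v g) (hvK : ∀ᵐ x, x ∉ K → v x = 0)
    (hdiv : ∀ φ, IsTestFunction (interior K) φ → ∑ i, ∫ x, coordDeriv i φ x * g i x = 0)
    (i : Fin n) : g i =ᵐ[volume] 0 := by
  have h := hK.sum_integral_mul_eq_zero hKc hv.memLp_grad hdiv hv hvK
  rw [Finset.sum_eq_zero_iff_of_nonneg
    (fun i _ => integral_nonneg fun x => mul_self_nonneg _)] at h
  have h2 := (integral_eq_zero_iff_of_nonneg (fun x => mul_self_nonneg (g i x))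
    ((hv.memLp_grad i).integrable_mul (hv.memLp_grad i))).1 (h i (Finset.mem_univ i))
  filter_upwards [h2] with x hx
  simpa using hx

theorem RCLike.eq_zero_of_re_im {z : 𝕜} (h1 : (RCLike.reCLM : 𝕜 →L[ℝ] ℝ) z = 0)
    (h2 : (RCLike.imCLM : 𝕜 →L[ℝ] ℝ) z = 0) : z = 0 :=
  RCLike.ext (by simpa using h1) (by simpa using h2)

theorem HasInteriorCones.grad_eq_zero_off_interior {K : Set (Eucl n)}
    (hK : HasInteriorCones K) (hKc : IsCompact K) {v : Eucl n → 𝕜} {g : Fin n → Eucl n → 𝕜}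
    (hv : HasWeakGrad v g) (hvK : ∀ᵐ x, x ∉ K → v x = 0) (i : Fin n) :
    ∀ᵐ x, x ∉ interior K → g i x = 0 := by
  have h (L : 𝕜 →L[ℝ] ℝ) := hK.grad_eq_zero_off_interior_real hKc (hv.comp_clm L)
    (by filter_upwards [hvK] with x hx hxK; rw [hx hxK, map_zero]) i
  filter_upwards [h RCLike.reCLM, h RCLike.imCLM] with x h1 h2 hx
  exact RCLike.eq_zero_of_re_im (h1 hx) (h2 hx)

theorem HasInteriorCones.grad_eq_zero_of_divergence {K : Set (Eucl n)}
    (hK : HasInteriorCones K) (hKc : IsCompact K) {v : Eucl n → 𝕜} {g : Fin n → Eucl n → 𝕜}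
    (hv : HasWeakGrad v g) (hvK : ∀ᵐ x, x ∉ K → v x = 0)
    (hdiv : ∀ φ : Eucl n → ℝ, IsTestFunction (interior K) φ →
      ∑ i, ∫ x, coordDeriv i φ x • g i x = 0)
    (i : Fin n) : g i =ᵐ[volume] 0 := by
  have h (L : 𝕜 →L[ℝ] ℝ) := hK.grad_eq_zero_of_divergence_real hKc (hv.comp_clm L)
    (by filter_upwards [hvK] with x hx hxK; rw [hx hxK, map_zero])
    (fun φ hφ => by
      rw [← map_zero L, ← hdiv φ hφ, map_sum]
      refine Finset.sum_congr rfl fun j _ => ?_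
      rw [← L.integral_comp_comm ((hφ.coordDeriv j).integrable_smul (hv.memLp_grad j))]
      simp) i
  filter_upwards [h RCLike.reCLM, h RCLike.imCLM] with x h1 h2
  exact RCLike.eq_zero_of_re_im h1 h2

end VanishingGradient

/-! ### Weak derivatives, Sobolev norms and `H¹₀` -/

section WeakDerivatives

variable {n : ℕ} {𝕜 : Type*} [RCLike 𝕜]

theorem partialDeriv_zero (I : Fin 0 → Fin n) (φ : Eucl n → ℝ) : partialDeriv I φ = φ := by
  ext x; simp [partialDeriv]

theorem partialDeriv_one (I : Fin 1 → Fin n) (φ : Eucl n → ℝ) :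
    partialDeriv I φ = coordDeriv (I 0) φ := by
  ext x; simp [partialDeriv, coordDeriv]

theorem coordDeriv_coordDeriv {φ : Eucl n → ℝ} (hφ : ContDiff ℝ ∞ φ) (i j : Fin n) (x : Eucl n) :
    coordDeriv i (coordDeriv j φ) x = fderiv ℝ (fderiv ℝ φ) x (EuclideanSpace.single i 1)
      (EuclideanSpace.single j 1) := by
  have h : DifferentiableAt ℝ (fderiv ℝ φ) x :=
    (hφ.fderiv_right (m := ∞) (by simp)).differentiable (by simp) x
  rw [coordDeriv]
  unfold coordDeriv
  rw [fderiv_clm_apply h (differentiableAt_const _)]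
  simp

theorem partialDeriv_two (I : Fin 2 → Fin n) {φ : Eucl n → ℝ} (hφ : ContDiff ℝ ∞ φ) :
    partialDeriv I φ = coordDeriv (I 0) (coordDeriv (I 1) φ) := by
  ext x
  rw [partialDeriv, iteratedFDeriv_two_apply, coordDeriv_coordDeriv hφ]

theorem laplacian_eq_sum_coordDeriv {φ : Eucl n → ℝ} (hφ : ContDiff ℝ ∞ φ) (x : Eucl n) :
    Laplacian.laplacian φ x = ∑ i, coordDeriv i (coordDeriv i φ) x := by
  rw [InnerProductSpace.laplacian_eq_iteratedFDeriv_orthonormalBasis φ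
    (EuclideanSpace.basisFun (Fin n) ℝ)]
  refine Finset.sum_congr rfl fun i _ => ?_
  rw [coordDeriv_coordDeriv hφ, iteratedFDeriv_two_apply]
  simp

theorem IsTestFunction.mono {F : Type*} [NormedAddCommGroup F] [NormedSpace ℝ F]
    {U V : Set (Eucl n)} {φ : Eucl n → F} (hφ : IsTestFunction U φ) (h : U ⊆ V) :
    IsTestFunction V φ :=
  ⟨hφ.1, hφ.2.1, hφ.2.2.trans h⟩

theorem IsWeakDeriv.mono {k : ℕ} {U V : Set (Eucl n)} {I : Fin k → Fin n} {u g : Eucl n → 𝕜}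
    (h : IsWeakDeriv V I u g) (hUV : U ⊆ V) : IsWeakDeriv U I u g :=
  ⟨h.1.mono_set hUV, h.2.1.mono_set hUV, fun φ hφ => h.2.2 φ (hφ.mono hUV)⟩

theorem integrable_smul_of_locallyIntegrableOn {U : Set (Eucl n)} {φ : Eucl n → ℝ}
    (hφ : IsTestFunction U φ) {g : Eucl n → 𝕜} (hg : LocallyIntegrableOn g U) :
    Integrable (fun x => φ x • g x) := by
  have h1 : IntegrableOn g (tsupport φ) := hg.integrableOn_compact_subset hφ.2.2 hφ.2.1
  have h2 : IntegrableOn (fun x => φ x • g x) (tsupport φ) :=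
    h1.continuousOn_smul hφ.1.continuous.continuousOn hφ.2.1
  refine (integrableOn_iff_integrable_of_support_subset fun x hx => ?_).1 h2
  exact subset_tsupport φ fun h => hx (by simp [h])

theorem IsWeakDeriv.ae_unique {k : ℕ} {U : Set (Eucl n)} (hU : IsOpen U) {I : Fin k → Fin n}
    {u g g' : Eucl n → 𝕜} (h : IsWeakDeriv U I u g) (h' : IsWeakDeriv U I u g') :
    ∀ᵐ x, x ∈ U → g x = g' x := by
  have := hU.ae_eq_zero_of_integral_contDiff_smul_eq_zero (h.2.1.sub h'.2.1) fun φ h1 h2 h3 => by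
    have hφ : IsTestFunction U φ := ⟨h1, h2, h3⟩
    simp only [Pi.sub_apply, smul_sub]
    rw [integral_sub (integrable_smul_of_locallyIntegrableOn hφ h.2.1)
      (integrable_smul_of_locallyIntegrableOn hφ h'.2.1), sub_eq_zero]
    have e := (h.2.2 φ hφ).symm.trans (h'.2.2 φ hφ)
    exact smul_right_injective 𝕜 (pow_ne_zero k (by norm_num : (-1 : ℝ) ≠ 0)) e
  filter_upwards [this] with x hx hxU
  exact sub_eq_zero.1 (hx hxU)

theorem isWeakDeriv_zero {U : Set (Eucl n)} (I : Fin 0 → Fin n) {u : Eucl n → 𝕜}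
    (hu : LocallyIntegrableOn u U) : IsWeakDeriv U I u u :=
  ⟨hu, hu, fun φ _ => by simp [partialDeriv_zero]⟩

theorem HasWeakGrad.isWeakDeriv {u : Eucl n → 𝕜} {g : Fin n → Eucl n → 𝕜} (h : HasWeakGrad u g)
    (I : Fin 1 → Fin n) : IsWeakDeriv univ I u (g (I 0)) :=
  ⟨(h.memLp.locallyIntegrable (by norm_num)).locallyIntegrableOn _,
    ((h.memLp_grad _).locallyIntegrable (by norm_num)).locallyIntegrableOn _, fun φ hφ => by
    rw [partialDeriv_one, h.integral_eq _ φ hφ]; simp⟩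

theorem MemSobolev.exists_hasWeakGrad {u : Eucl n → 𝕜} (hu : MemSobolev 1 univ u) :
    ∃ g, HasWeakGrad u g := by
  obtain ⟨v, hv, hv2⟩ := hu 0 (by simp) Fin.elim0
  rw [Measure.restrict_univ] at hv2
  have huv := hv.ae_unique isOpen_univ (isWeakDeriv_zero _ hv.1)
  have hu2 : MemLp u 2 := hv2.ae_eq (by filter_upwards [huv] with x hx; exact hx trivial)
  choose g hg hg2 using fun i => hu 1 le_rfl (fun _ : Fin 1 => i)
  refine ⟨g, hu2, fun i => by simpa using hg2 i, fun i φ hφ => ?_⟩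
  have := (hg i).2.2 φ hφ
  rw [partialDeriv_one] at this
  simpa using this

theorem weakDerivNorm_le_sobolevNorm {k m : ℕ} (hk : k ≤ m) (U : Set (Eucl n))
    (I : Fin k → Fin n) (u : Eucl n → 𝕜) : weakDerivNorm U I u ≤ sobolevNorm m U u := by
  have h : weakDerivNorm U I u ^ 2 ≤
      ∑ k ∈ Finset.range (m + 1), ∑ I : Fin k → Fin n, weakDerivNorm U I u ^ 2 :=
    (Finset.single_le_sum (f := fun I : Fin k → Fin n => weakDerivNorm U I u ^ 2)
      (fun _ _ => zero_le) (Finset.mem_univ I)).trans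
    (Finset.single_le_sum (f := fun k => ∑ I : Fin k → Fin n, weakDerivNorm U I u ^ 2)
      (fun _ _ => zero_le) (Finset.mem_range.2 (Nat.lt_succ_of_le hk)))
  have h2 := ENNReal.rpow_le_rpow h (show (0 : ℝ) ≤ 1 / 2 by norm_num)
  rwa [← ENNReal.rpow_natCast, ← ENNReal.rpow_mul, show ((2 : ℕ) : ℝ) * (1 / 2) = 1 by norm_num,
    ENNReal.rpow_one] at h2

/-- Each derivative norm is an infimum, so the strict bound produces an actual derivative. -/
theorem exists_isWeakDeriv_of_sobolevNorm_lt {k m : ℕ} (hk : k ≤ m) {U : Set (Eucl n)}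
    (I : Fin k → Fin n) {u : Eucl n → 𝕜} {M : ℝ≥0∞} (h : sobolevNorm m U u < M) :
    ∃ g, IsWeakDeriv U I u g ∧ MemLp g 2 (volume.restrict U) ∧
      eLpNorm g 2 (volume.restrict U) ≤ M := by
  have h1 := (weakDerivNorm_le_sobolevNorm hk U I u).trans_lt h
  simp only [weakDerivNorm, iInf_lt_iff] at h1
  obtain ⟨g, ⟨hg, hg2⟩, hM⟩ := h1
  exact ⟨g, hg, hg2, hM.le⟩

theorem IsWeakDeriv.eLpNorm_le_of_sobolevNorm_lt {k m : ℕ} (hk : k ≤ m) {U : Set (Eucl n)}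
    (hU : IsOpen U) {I : Fin k → Fin n} {u g : Eucl n → 𝕜} {M : ℝ≥0∞} (hg : IsWeakDeriv U I u g)
    (h : sobolevNorm m U u < M) : eLpNorm g 2 (volume.restrict U) ≤ M := by
  obtain ⟨g', h1, -, h3⟩ := exists_isWeakDeriv_of_sobolevNorm_lt hk I h
  rwa [eLpNorm_congr_ae ((ae_restrict_iff' hU.measurableSet).2 (hg.ae_unique hU h1))]

theorem eLpNorm_eq_restrict_of_ae_zero {U : Set (Eucl n)} (hU : MeasurableSet U) {g : Eucl n → 𝕜}
    (h : ∀ᵐ x, x ∉ U → g x = 0) : eLpNorm g 2 volume = eLpNorm g 2 (volume.restrict U) := by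
  rw [← eLpNorm_indicator_eq_eLpNorm_restrict hU]
  refine eLpNorm_congr_ae ?_
  filter_upwards [h] with x hx
  by_cases hxU : x ∈ U
  · simp [hxU]
  · simp [hxU, hx hxU]

/-- Elements of `H¹₀(K)` vanish almost everywhere off the interior of `K`. -/
theorem MemSobolevZero.ae_eq_zero {K : Set (Eucl n)} {u : Eucl n → 𝕜}
    (hu : MemSobolevZero 1 K u) : ∀ᵐ x, x ∉ interior K → u x = 0 := by
  obtain ⟨h1, φ, hφ, hlim⟩ := hu
  obtain ⟨g, hg⟩ := h1.exists_hasWeakGrad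
  have hm : MeasurableSet (interior K)ᶜ := isOpen_interior.measurableSet.compl
  have hφ0 : ∀ k, ∀ x ∉ interior K, φ k x = 0 := by
    -- Off the interior of `K` lies the closure of the complement, where a continuous function
    -- supported in `K` vanishes.
    intro k x hx
    have hx' : x ∈ closure Kᶜ := by rwa [closure_compl]
    have hcl : IsClosed {x | φ k x = 0} := isClosed_eq (hφ k).1.continuous continuous_const
    refine closure_minimal (fun y hy => ?_) hcl hx'
    exact image_eq_zero_of_notMem_tsupport fun h => hy ((hφ k).2.2 h)
  have hle : ∀ M : ℝ≥0∞, 0 < M → eLpNorm u 2 (volume.restrict (interior K)ᶜ) ≤ M := by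
    intro M hM
    obtain ⟨k, hk⟩ := (hlim.eventually_lt_const hM).exists
    have hint : LocallyIntegrableOn (φ k - u) univ :=
      ((((hφ k).memLp 2).sub hg.memLp).locallyIntegrable (by norm_num)).locallyIntegrableOn _
    have h2 := (isWeakDeriv_zero Fin.elim0 hint).eLpNorm_le_of_sobolevNorm_lt zero_le_one
      isOpen_univ hk
    rw [Measure.restrict_univ] at h2
    refine le_trans (le_of_eq ?_) ((eLpNorm_mono_measure _
      (Measure.restrict_le_self (s := (interior K)ᶜ))).trans h2)
    rw [← eLpNorm_neg]
    refine eLpNorm_congr_ae ((ae_restrict_iff' hm).2 (.of_forall fun x hx => ?_))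
    simp [hφ0 k x hx]
  have h0 : eLpNorm u 2 (volume.restrict (interior K)ᶜ) = 0 :=
    le_antisymm (le_of_forall_gt_imp_ge_of_dense fun M hM => hle M hM) zero_le
  rw [eLpNorm_eq_zero_iff hg.memLp.aestronglyMeasurable.restrict (by simp)] at h0
  exact (ae_restrict_iff' hm).1 h0

end WeakDerivatives

/-! ### Weak limits and the weak form of the equation -/

section Convergence

variable {n : ℕ} {𝕜 : Type*} [RCLike 𝕜]

theorem exists_weak_limit_testFunction {ι : Type*} (U : Ultrafilter ι) {F : ι → Eucl n → 𝕜}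
    {M : ℝ≥0∞} (hM : M ≠ ⊤) (hF : ∀ᶠ k in (U : Filter ι), MemLp (F k) 2 ∧ eLpNorm (F k) 2 ≤ M) :
    ∃ F₀ : Eucl n → 𝕜, MemLp F₀ 2 ∧ ∀ φ : Eucl n → ℝ, IsTestFunction univ φ →
      Tendsto (fun k => ∫ x, φ x • F k x) U (𝓝 (∫ x, φ x • F₀ x)) := by
  obtain ⟨F₀, h0, h1⟩ := exists_weak_limit U hM hF
  refine ⟨F₀, h0, fun φ hφ => ?_⟩
  have : MemLp (fun x => (φ x : 𝕜)) 2 := (hφ.memLp 2).ofReal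
  simpa only [RCLike.real_smul_eq_coe_mul] using h1 _ this

theorem HasWeakGrad.sum_integral_coordDeriv_smul {u f : Eucl n → 𝕜} {g : Fin n → Eucl n → 𝕜}
    (h : HasWeakGrad u g) {U : Set (Eucl n)} (hΔ : WeakLaplaceEq U u f) {φ : Eucl n → ℝ}
    (hφ : IsTestFunction U φ) : ∑ i, ∫ x, coordDeriv i φ x • g i x = -∫ x, φ x • f x := by
  have hφu := hφ.mono (subset_univ U)
  rw [← hΔ φ hφ]
  simp_rw [laplacian_eq_sum_coordDeriv hφ.1, Finset.sum_smul]
  rw [integral_finsetSum _ fun i _ =>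
    (((hφu.coordDeriv i).coordDeriv i).integrable_smul h.memLp), ← Finset.sum_neg_distrib]
  refine Finset.sum_congr rfl fun i _ => ?_
  rw [h.integral_eq i _ (hφu.coordDeriv i), neg_neg]

end Convergence

/-! ### The main theorem -/

theorem mainTheorem11 {𝕜 : Type*} [RCLike 𝕜] (n : ℕ)
    (G : Set (Eucl n)) (Ω : ℕ → Set (Eucl n))
    (hG : IsClosedLipschitzDomain G)
    (hΩ : ∀ k, IsClosedSmoothDomain (Ω k))
    (hanti : ∀ k, Ω (k + 1) ⊆ Ω k)
    (hinter : G = ⋂ k, Ω k)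
    (f : Eucl n → 𝕜) (hf : MemLp f 2 (volume.restrict (Ω 0)))
    (u : ℕ → Eucl n → 𝕜) (w : Eucl n → 𝕜)
    (hu : ∀ k, MemSobolevZero 1 (Ω k) (u k))
    (hw : MemSobolevZero 1 G w)
    (hΔu : ∀ k, WeakLaplaceEq (interior (Ω k)) (u k) f)
    (hΔw : WeakLaplaceEq (interior G) w f)
    (hw2 : ¬ MemSobolev 2 (interior G) w) :
    Tendsto (fun k => sobolevNorm 2 (interior (Ω k)) (u k)) atTop (𝓝 ⊤) := by
  have hanti' : Antitone Ω := antitone_nat_of_succ_le hanti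
  have hGΩ : ∀ k, interior G ⊆ interior (Ω k) := fun k =>
    interior_mono (hinter ▸ iInter_subset _ k)
  by_contra hcon
  apply hw2
  -- a subfamily that is bounded in `H²`, and weak limits along an ultrafilter
  obtain ⟨M, hMtop, hfreq⟩ : ∃ M : ℝ≥0∞, M ≠ ⊤ ∧
      ∃ᶠ k in atTop, sobolevNorm 2 (interior (Ω k)) (u k) < M := by
    rw [ENNReal.tendsto_nhds_top_iff_nnreal] at hcon
    push Not at hcon
    obtain ⟨M, hM⟩ := hcon
    refine ⟨M + 1, by simp, hM.mono fun k hk => hk.trans_lt ?_⟩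
    exact ENNReal.lt_add_right ENNReal.coe_ne_top one_ne_zero
  have hne : (atTop ⊓ 𝓟 {k | sobolevNorm 2 (interior (Ω k)) (u k) < M}).NeBot :=
    frequently_mem_iff_neBot.1 hfreq
  set U := Ultrafilter.of (atTop ⊓ 𝓟 {k | sobolevNorm 2 (interior (Ω k)) (u k) < M})
  have hU : (U : Filter ℕ) ≤ atTop ⊓ 𝓟 {k | sobolevNorm 2 (interior (Ω k)) (u k) < M} :=
    Ultrafilter.of_le _
  have hUM : ∀ᶠ k in (U : Filter ℕ), sobolevNorm 2 (interior (Ω k)) (u k) < M :=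
    (hU.trans inf_le_right) (mem_principal_self _)
  have hUtop : (U : Filter ℕ) ≤ atTop := hU.trans inf_le_left
  choose g hg using fun k => (hu k).1.exists_hasWeakGrad
  obtain ⟨gw, hgw⟩ := hw.1.exists_hasWeakGrad
  have hu0 := fun k => (hu k).ae_eq_zero
  have hcpt : ∀ k, IsCompact (Ω k) := fun k =>
    Metric.isCompact_of_isClosed_isBounded (hΩ k).isClosed (hΩ k).isBounded
  have hm : ∀ k, MeasurableSet (interior (Ω k)) := fun k => isOpen_interior.measurableSet
  -- Needed because the assumed bounds hold only on `interior (Ω k)`, whereas the weak limits are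
  -- taken in `L²(ℝⁿ)`.
  have hg0 : ∀ k i, ∀ᵐ x, x ∉ interior (Ω k) → g k i x = 0 := fun k i =>
    (hΩ k).hasInteriorCones.grad_eq_zero_off_interior (hcpt k) (hg k) (by
      filter_upwards [hu0 k] with x hx hxK
      exact hx fun h => hxK (interior_subset h)) i
  obtain ⟨v, hv2, hv⟩ := exists_weak_limit_testFunction U hMtop (F := u) (by
    filter_upwards [hUM] with k hk
    refine ⟨(hg k).memLp, ?_⟩
    rw [eLpNorm_eq_restrict_of_ae_zero (hm k) (hu0 k)]
    exact (isWeakDeriv_zero Fin.elim0 (((hg k).memLp.locallyIntegrable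
      (by norm_num)).locallyIntegrableOn _)).eLpNorm_le_of_sobolevNorm_lt (by norm_num)
      isOpen_interior hk)
  choose gv hgv2 hgv using fun i : Fin n =>
    exists_weak_limit_testFunction U hMtop (F := fun k => g k i) (by
      filter_upwards [hUM] with k hk
      refine ⟨(hg k).memLp_grad i, ?_⟩
      rw [eLpNorm_eq_restrict_of_ae_zero (hm k) (hg0 k i)]
      exact (((hg k).isWeakDeriv fun _ => i).mono (subset_univ _)).eLpNorm_le_of_sobolevNorm_lt
        (by norm_num) isOpen_interior hk)
  choose! h hh hh2 hhM using fun (k : ℕ) (hk : sobolevNorm 2 (interior (Ω k)) (u k) < M)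
    (I : Fin 2 → Fin n) => exists_isWeakDeriv_of_sobolevNorm_lt le_rfl I hk
  -- Zero extension puts the second derivatives in one space. It need not be a weak derivative
  -- across the boundary; only test functions inside `G` are used below.
  choose H hH2 hH using fun I : Fin 2 → Fin n =>
    exists_weak_limit_testFunction U hMtop
      (F := fun k => (interior (Ω k)).indicator (h k I)) (by
      filter_upwards [hUM] with k hk
      rw [memLp_indicator_iff_restrict (hm k), eLpNorm_indicator_eq_eLpNorm_restrict (hm k)]
      exact ⟨hh2 k hk I, hhM k hk I⟩)
  -- the weak limit is in `H¹`, vanishes off `G` and solves the limit equation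
  have hvg : HasWeakGrad v gv := by
    refine ⟨hv2, hgv2, fun i φ hφ => tendsto_nhds_unique (hv _ (hφ.coordDeriv i)) ?_⟩
    simp_rw [(hg _).integral_eq i φ hφ]
    exact (hgv i φ hφ).neg
  have hv0 : ∀ᵐ x, x ∉ G → v x = 0 := by
    have : ∀ m, ∀ᵐ x, x ∈ (Ω m)ᶜ → v x = 0 := by
      intro m
      refine (hΩ m).isClosed.isOpen_compl.ae_eq_zero_of_integral_contDiff_smul_eq_zero
        ((hv2.locallyIntegrable (by norm_num)).locallyIntegrableOn _) fun φ h1 h2 h3 => ?_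
      refine tendsto_nhds_unique (hv φ ⟨h1, h2, subset_univ _⟩)
        (tendsto_const_nhds.congr' ?_)
      filter_upwards [hUtop (eventually_ge_atTop m)] with k hk
      refine (integral_eq_zero_of_ae ?_).symm
      filter_upwards [hu0 k] with x hx
      by_cases hxm : x ∈ Ω m
      · have : φ x = 0 := image_eq_zero_of_notMem_tsupport fun h => h3 h hxm
        simp [this]
      · simp [hx fun h => hxm (hanti' hk (interior_subset h))]
    filter_upwards [ae_all_iff.2 this] with x hx hxG
    rw [hinter, mem_iInter, not_forall] at hxG
    obtain ⟨m, hm⟩ := hxG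
    exact hx m hm
  have hdiv : ∀ φ : Eucl n → ℝ, IsTestFunction (interior G) φ →
      ∑ i, ∫ x, coordDeriv i φ x • (gv i x - gw i x) = 0 := by
    intro φ hφ
    have hφu := hφ.mono (subset_univ _)
    have h1 : ∑ i, ∫ x, coordDeriv i φ x • gv i x = -∫ x, φ x • f x := by
      refine tendsto_nhds_unique
        (tendsto_finsetSum _ fun i _ => hgv i _ (hφu.coordDeriv i)) ?_
      simp_rw [(hg _).sum_integral_coordDeriv_smul (hΔu _) (hφ.mono (hGΩ _))]
      exact tendsto_const_nhds
    have h2 := hgw.sum_integral_coordDeriv_smul hΔw hφ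
    rw [← sub_eq_zero.2 (h1.trans h2.symm), ← Finset.sum_sub_distrib]
    refine Finset.sum_congr rfl fun i _ => ?_
    simp_rw [smul_sub]
    exact integral_sub ((hφu.coordDeriv i).integrable_smul (hgv2 i))
      ((hφu.coordDeriv i).integrable_smul (hgw.memLp_grad i))
  have heq : ∀ i, ∀ᵐ x, gv i x - gw i x = 0 := fun i =>
    hG.hasInteriorCones.grad_eq_zero_of_divergence
      (Metric.isCompact_of_isClosed_isBounded hG.isClosed hG.isBounded) (hvg.sub hgw) (by
        filter_upwards [hv0, hw.ae_eq_zero] with x h1 h2 hx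
        rw [h1 hx, h2 fun h => hx (interior_subset h), sub_zero]) hdiv i
  -- the second derivatives of `w` are the weak limits of those of the `u k`
  intro k hk I
  rcases Nat.lt_or_ge k 2 with hk1 | hk2
  · obtain ⟨g', h1, h2⟩ := hw.1 k (Nat.lt_succ_iff.1 hk1) I
    exact ⟨g', h1.mono (subset_univ _), h2.mono_measure (Measure.restrict_mono_set _ (subset_univ _))⟩
  · obtain rfl : k = 2 := le_antisymm hk hk2
    refine ⟨H I, ⟨(hgw.memLp.locallyIntegrable (by norm_num)).locallyIntegrableOn _,
      ((hH2 I).locallyIntegrable (by norm_num)).locallyIntegrableOn _, fun φ hφ => ?_⟩,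
      (hH2 I).restrict _⟩
    have hφu := hφ.mono (subset_univ _)
    have hd := hφu.coordDeriv (I 1)
    -- Equal gradients suffice: one derivative is moved onto the function, so `v = w` is never
    -- needed.
    have e1 : ∫ x, partialDeriv I φ x • w x = ∫ x, partialDeriv I φ x • v x := by
      rw [partialDeriv_two I hφ.1, hgw.integral_eq _ _ hd, hvg.integral_eq _ _ hd]
      congr 1
      refine integral_congr_ae ?_
      filter_upwards [heq (I 0)] with x hx
      rw [sub_eq_zero.1 hx]
    rw [e1]
    simp only [even_two, Even.neg_pow, one_pow, one_smul]
    have h1 := hv _ (hd.coordDeriv (I 0))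
    rw [← partialDeriv_two I hφ.1] at h1
    refine tendsto_nhds_unique h1 ((hH I φ hφu).congr' ?_)
    filter_upwards [hUM] with k hk
    rw [(hh k hk I).2.2 φ (hφ.mono (hGΩ k))]
    simp only [even_two, Even.neg_pow, one_pow, one_smul]
    refine integral_congr_ae (.of_forall fun x => ?_)
    by_cases hx : x ∈ interior (Ω k)
    · simp [hx]
    · have : φ x = 0 := image_eq_zero_of_notMem_tsupport fun h => hx (hGΩ k (hφ.2.2 h))
      simp [this]
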